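/- Let $\tau_{\mathsf{ord}}=\langle <;\mathsf{min},\mathsf{max}\rangle$ be the vocabulary with a binary relation symbol $<$ and two constant symbols. For $m\ge 1$ let $L_m$ be the linear order with $m+1$ elements (its length is $m$), in which $\mathsf{min}$ and $\mathsf{max}$ denote the first and the last element. For $\ell\ge 1$, a first-order sentence (with equality) over $\tau_{\mathsf{ord}}$ separates $L_{\le \ell}$ from $L_{>\ell}$ if it is true in $L_m$ for all $1\le m\le \ell$ and false in $L_m$ for all $m>\ell$. Let $r(\ell)$ be the minimum quantifier rank, and $q(\ell)$ the minimum number of quantifiers, of a sentence that separates $L_{\le \ell}$ from $L_{>\ell}$. For $Q\in\{\exists,\forall\}$ let $q_Q(\ell)$ be the minimum number of quantifiers of such a separating sentence that is in prenex normal form with leading quantifier $Q$. **Theorem.** For all $\ell\ge 1$, separating sentences of each of these kinds exist, and $$r(\ell)=1+\lfloor\log_2 \ell\rfloor,\qquad r(\ell)\le q(\ell)\le r(\ell)+1,\qquad q_\exists(\ell)\le r(\ell)+1,\qquad q_\forall(\ell)\le r(\ell)+1 .$$ -/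

import Mathlib

open FirstOrder

namespace LinOrdSep

/-- Function symbols of the vocabulary of orders: the constants `min` and `max`. -/
inductive OrdFunc : ℕ → Type
  | min : OrdFunc 0
  | max : OrdFunc 0

/-- Relation symbols of the vocabulary of orders: the binary predicate `<`. -/
inductive OrdRel : ℕ → Type
  | lt : OrdRel 2

/-- The vocabulary `⟨< ; min, max⟩` of orders (equality is a logical symbol). -/
def ordLang : FirstOrder.Language.{0, 0} := ⟨OrdFunc, OrdRel⟩

/-- The linear order `L_m` of length `m`: it has the `m + 1` elements `0 < 1 < ⋯ < m`, and
`min`, `max` are interpreted as the first and the last of them. -/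
instance linOrd (m : ℕ) : ordLang.Structure (Fin (m + 1)) where
  funMap := fun f _ =>
    match f with
    | OrdFunc.min => 0
    | OrdFunc.max => Fin.last m
  RelMap := fun R =>
    match R with
    | OrdRel.lt => fun v => v 0 < v 1

section Formulas

variable {L : FirstOrder.Language.{0, 0}} {α : Type}

/-- The number of quantifiers of a formula. In Mathlib `∀` is primitive, `∃ x, φ` stands for
`¬ ∀ x, ¬ φ`, and the connectives are built from `⊥` and `→`, so that every occurrence of a
quantifier `∀` or `∃` counts exactly once. -/
def numQuantifiers : {n : ℕ} → L.BoundedFormula α n → ℕ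
  | _, .falsum => 0
  | _, .equal _ _ => 0
  | _, .rel _ _ => 0
  | _, .imp φ ψ => numQuantifiers φ + numQuantifiers ψ
  | _, .all φ => numQuantifiers φ + 1

/-- The quantifier rank of a formula: the maximal depth of nested quantifiers. -/
def quantifierRank : {n : ℕ} → L.BoundedFormula α n → ℕ
  | _, .falsum => 0
  | _, .equal _ _ => 0
  | _, .rel _ _ => 0
  | _, .imp φ ψ => max (quantifierRank φ) (quantifierRank ψ)
  | _, .all φ => quantifierRank φ + 1

/-- The two quantifiers. -/
inductive Quantifier
  | all
  | ex

/-- `φ` is a formula in prenex form whose leading quantifier is `Q`. -/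
def IsPrenexStartingWith : Quantifier → {n : ℕ} → L.BoundedFormula α n → Prop
  | .all, n, φ => ∃ ψ : L.BoundedFormula α (n + 1), ψ.IsPrenex ∧ φ = ψ.all
  | .ex, n, φ => ∃ ψ : L.BoundedFormula α (n + 1), ψ.IsPrenex ∧ φ = ψ.ex

end Formulas

/-- `φ` separates `L_{≤ ℓ}` from `L_{> ℓ}`: it is true in every linear order of (positive)
length at most `ℓ` and false in every linear order of length greater than `ℓ`. -/
def Separates (ℓ : ℕ) (φ : ordLang.Sentence) : Prop :=
  (∀ m : ℕ, 1 ≤ m → m ≤ ℓ → Fin (m + 1) ⊨ φ) ∧ (∀ m : ℕ, ℓ < m → ¬ Fin (m + 1) ⊨ φ)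

/-- `r(ℓ)`: the minimum quantifier rank of a sentence separating `L_{≤ ℓ}` from `L_{> ℓ}`
(it would be `⊤` if there were no such sentence). -/
noncomputable def minRank (ℓ : ℕ) : ℕ∞ :=
  ⨅ (φ : ordLang.Sentence) (_ : Separates ℓ φ), (quantifierRank φ : ℕ∞)

/-- `q(ℓ)`: the minimum number of quantifiers of a sentence separating `L_{≤ ℓ}` from
`L_{> ℓ}`. -/
noncomputable def minQuant (ℓ : ℕ) : ℕ∞ :=
  ⨅ (φ : ordLang.Sentence) (_ : Separates ℓ φ), (numQuantifiers φ : ℕ∞)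

/-- `q_∀(ℓ)` and `q_∃(ℓ)`: the minimum number of quantifiers of a prenex sentence that starts
with the quantifier `Q` and separates `L_{≤ ℓ}` from `L_{> ℓ}`. -/
noncomputable def minQuantStarting (Q : Quantifier) (ℓ : ℕ) : ℕ∞ :=
  ⨅ (φ : ordLang.Sentence) (_ : Separates ℓ φ ∧ IsPrenexStartingWith Q φ),
    (numQuantifiers φ : ℕ∞)

end LinOrdSep

namespace LinOrdSep

open FirstOrder.Language

/-! Lower bound: a correspondence of marked points preserving order and distances truncated at `2 *
K` extends by any new point at the cost of truncating at `K` (`PreservesDist.extend`). Hence rank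
`k` cannot distinguish orders whose marked points agree up to distance `2 ^ k`
(`realize_iff_of_preservesDist`), in particular lengths `ℓ` and `ℓ + 1` when `2 ^ k ≤ ℓ`.

Upper bounds: bisecting an interval expresses any distance up to `2 ^ k` in rank `k`. When
quantifiers are counted, both halves must share one prefix. A new point lies on one side of the
common endpoint `z` of two adjacent intervals, so one variable serves both: `∃` bisects whichever
interval is long (`ExpressesBoth.ex`), `∀` tests each of them (`ExpressesEither.all`). These steps
turn a bound `S` into `2 * S` and `2 * S - 1`, so `k + 2` alternating quantifiers, up to the
innermost ones, reach `2 ^ (k + 1) + 1`. -/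

/-! ### Lower bound: truncated distances -/

/-- The correspondence `R` between points of two orders preserves order and distances, where
all distances that are at least `K` are identified. -/
def PreservesDist (K : ℕ) (R : ℕ → ℕ → Prop) : Prop :=
  ∀ a a' b b', R a a' → R b b' → min (b - a) K = min (b' - a') K

theorem PreservesDist.swap {K : ℕ} {R : ℕ → ℕ → Prop} (h : PreservesDist K R) :
    PreservesDist K (fun a' a => R a a') :=
  fun a' a b' b ha hb => (h a a' b b' ha hb).symm

/-- A distance below `K` from either end is copied exactly; if both are at least `K`, the point at
distance `K` from `p'` works. -/
theorem exists_between_min_sub_eq {K p q x p' q' : ℕ} (hpx : p ≤ x) (hxq : x ≤ q) (hpq' : p' ≤ q')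
    (h : min (q - p) (K * 2) = min (q' - p') (K * 2)) :
    ∃ x', p' ≤ x' ∧ x' ≤ q' ∧ min (x - p) K = min (x' - p') K ∧
      min (q - x) K = min (q' - x') K := by
  obtain ⟨i, rfl⟩ := Nat.exists_eq_add_of_le hpx
  obtain ⟨j, rfl⟩ := Nat.exists_eq_add_of_le hxq
  obtain ⟨d, rfl⟩ := Nat.exists_eq_add_of_le hpq'
  rw [Nat.add_assoc, Nat.add_sub_cancel_left, Nat.add_sub_cancel_left] at h
  simp only [Nat.add_sub_cancel_left]
  by_cases c1 : i < K
  · exact ⟨p' + i, by omega, by omega, by omega, by omega⟩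
  · by_cases c2 : j < K
    · exact ⟨p' + (d - j), by omega, by omega, by omega, by omega⟩
    · exact ⟨p' + K, by omega, by omega, by omega, by omega⟩

/-- Only the nearest marked points `p ≤ x ≤ q` constrain the answer; distances to other marked
points add up through `p` or `q`. -/
theorem PreservesDist.extend {K m m' x : ℕ} {R : ℕ → ℕ → Prop} (hK : 0 < K)
    (h : PreservesDist (K * 2) R) (h0 : R 0 0) (hm : R m m') (hx : x ≤ m) :
    ∃ x' ≤ m', PreservesDist K (fun a a' => R a a' ∨ (a = x ∧ a' = x')) := by
  classical
  obtain ⟨p, p', hp, hpx, hpmax⟩ : ∃ p p', R p p' ∧ p ≤ x ∧ ∀ a a', R a a' → a ≤ x → a ≤ p := by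
    have key := Nat.findGreatest_spec (P := fun a => ∃ a', R a a') (Nat.zero_le x) ⟨0, h0⟩
    obtain ⟨p', hp'⟩ := key
    exact ⟨_, p', hp', Nat.findGreatest_le x, fun a a' ha hax => Nat.le_findGreatest hax ⟨a', ha⟩⟩
  obtain ⟨q, q', hq, hxq, hqmin⟩ : ∃ q q', R q q' ∧ x ≤ q ∧ ∀ a a', R a a' → x ≤ a → q ≤ a := by
    have hex : ∃ a, (∃ a', R a a') ∧ x ≤ a := ⟨m, ⟨m', hm⟩, hx⟩
    obtain ⟨⟨q', hq'⟩, hxq⟩ := Nat.find_spec hex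
    exact ⟨_, q', hq', hxq, fun a a' ha hax => Nat.find_min' hex ⟨⟨a', ha⟩, hax⟩⟩
  have hpq := h p p' q q' hp hq
  have hqp := h q q' p p' hq hp
  obtain ⟨x', h1, h2, h3, h4⟩ :=
    exists_between_min_sub_eq hpx hxq (by clear hpq; omega) hpq
  have key : ∀ l l', R l l' →
      min (x - l) K = min (x' - l') K ∧ min (l - x) K = min (l' - x') K := by
    intro l l' hl
    have h₁ := h p p' l l' hp hl
    have h₂ := h l l' p p' hl hp
    have h₃ := h q q' l l' hq hl
    have h₄ := h l l' q q' hl hq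
    have hlx := hpmax l l' hl
    have hxl := hqmin l l' hl
    clear hpq hqp
    rcases le_total l x with c | c
    · have := hlx c
      clear h₃ h₄ hxl h4
      constructor <;> omega
    · have := hxl c
      clear h₁ h₂ hlx h3
      constructor <;> omega
  refine ⟨x', ?_, ?_⟩
  · have := h m m' q q' hm hq
    have := hqmin m m' hm hx
    omega
  · rintro a a' b b' (ha | ⟨rfl, rfl⟩) (hb | ⟨rfl, rfl⟩)
    · have := h a a' b b' ha hb
      omega
    · exact (key a a' ha).1
    · exact (key b b' hb).2
    · simp

theorem term_realize_rel {n m m' : ℕ} {R : ℕ → ℕ → Prop} {e : Empty → Fin (m + 1)}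
    {e' : Empty → Fin (m' + 1)} (h0 : R 0 0) (hm : R m m')
    {v : Fin n → Fin (m + 1)} {v' : Fin n → Fin (m' + 1)} (hv : ∀ i, R (v i) (v' i))
    (t : ordLang.Term (Empty ⊕ Fin n)) :
    R (t.realize (Sum.elim e v) : Fin (m + 1)) (t.realize (Sum.elim e' v') : Fin (m' + 1)) := by
  match t with
  | .var (.inl i) => exact i.elim
  | .var (.inr i) => exact hv i
  | .func (l := 0) OrdFunc.min ts => exact h0
  | .func (l := 0) OrdFunc.max ts => exact hm

theorem realize_iff_of_preservesDist {n : ℕ} (φ : ordLang.BoundedFormula Empty n) :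
    ∀ {k m m' : ℕ} {R : ℕ → ℕ → Prop}, quantifierRank φ ≤ k → PreservesDist (2 ^ k) R →
      R 0 0 → R m m' → ∀ {e : Empty → Fin (m + 1)} {e' : Empty → Fin (m' + 1)}
      {v : Fin n → Fin (m + 1)} {v' : Fin n → Fin (m' + 1)},
      (∀ i, R (v i) (v' i)) → (φ.Realize e v ↔ φ.Realize e' v') := by
  induction φ with
  | falsum => intros; rfl
  | equal t₁ t₂ =>
    intro k m m' R _ h h0 hm e e' v v' hv
    have r1 := term_realize_rel (e := e) (e' := e') h0 hm hv t₁
    have r2 := term_realize_rel (e := e) (e' := e') h0 hm hv t₂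
    have h₁ := h _ _ _ _ r1 r2
    have h₂ := h _ _ _ _ r2 r1
    have hK : 0 < 2 ^ k := by positivity
    simp only [BoundedFormula.Realize, Fin.ext_iff]
    omega
  | rel r ts =>
    intro k m m' R _ h h0 hm e e' v v' hv
    cases r
    have r1 := term_realize_rel (e := e) (e' := e') h0 hm hv (ts 0)
    have r2 := term_realize_rel (e := e) (e' := e') h0 hm hv (ts 1)
    have h₁ := h _ _ _ _ r1 r2
    have hK : 0 < 2 ^ k := by positivity
    change (_ < _) ↔ (_ < _)
    rw [Fin.lt_def, Fin.lt_def]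
    beta_reduce
    omega
  | imp φ ψ ih1 ih2 =>
    intro k m m' R hk h h0 hm e e' v v' hv
    simp only [quantifierRank, max_le_iff] at hk
    exact imp_congr (ih1 hk.1 h h0 hm hv) (ih2 hk.2 h h0 hm hv)
  | @all n φ ih =>
    intro k m m' R hk h h0 hm e e' v v' hv
    obtain ⟨k, rfl⟩ : ∃ j, k = j + 1 := ⟨k - 1, by simp only [quantifierRank] at hk; omega⟩
    have hk : quantifierRank φ ≤ k := by simpa [quantifierRank] using hk
    rw [pow_succ] at h
    simp only [BoundedFormula.Realize]
    constructor
    · intro H x'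
      obtain ⟨x, hx, hR⟩ := h.swap.extend (by positivity) h0 hm (Nat.le_of_lt_succ x'.isLt)
      refine (ih hk hR.swap (.inl h0) (.inl hm) ?_).1 (H ⟨x, Nat.lt_succ_of_le hx⟩)
      intro i
      refine Fin.lastCases ?_ (fun i => ?_) i
      · simp
      · simpa using .inl (hv i)
    · intro H x
      obtain ⟨x', hx, hR⟩ := h.extend (by positivity) h0 hm (Nat.le_of_lt_succ x.isLt)
      refine (ih hk hR (.inl h0) (.inl hm) ?_).2 (H ⟨x', Nat.lt_succ_of_le hx⟩)
      intro i
      refine Fin.lastCases ?_ (fun i => ?_) i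
      · simp
      · simpa using .inl (hv i)

theorem Separates.log_lt_quantifierRank {ℓ : ℕ} (hℓ : 1 ≤ ℓ) {φ : ordLang.Sentence}
    (h : Separates ℓ φ) : 1 + Nat.log 2 ℓ ≤ quantifierRank φ := by
  by_contra hlt
  have hpow : 2 ^ quantifierRank φ ≤ ℓ :=
    (Nat.pow_le_pow_right (by norm_num) (by omega)).trans (Nat.pow_log_le_self 2 (by omega))
  have hR : PreservesDist (2 ^ quantifierRank φ)
      (fun a a' => (a = 0 ∧ a' = 0) ∨ (a = ℓ ∧ a' = ℓ + 1)) := by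
    intro a a' b b' ha hb
    omega
  exact h.2 (ℓ + 1) (by omega) ((realize_iff_of_preservesDist φ le_rfl hR (.inl ⟨rfl, rfl⟩)
    (.inr ⟨rfl, rfl⟩) (m := ℓ) (m' := ℓ + 1)
    (fun i => i.elim0)).1 (h.1 ℓ hℓ le_rfl))

/-! ### Definable predicates and quantifier-free formulas -/

/-- A predicate on `n`-tuples of points, for all orders `L_m` simultaneously. -/
abbrev OrdPred (n : ℕ) := ∀ m : ℕ, (Fin n → Fin (m + 1)) → Prop

/-- A name for a point of an order with `n` distinguished points. -/
inductive OrdPoint (n : ℕ)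
  | min
  | max
  | var (i : Fin n)

namespace OrdPoint

variable {n m : ℕ}

/-- The element of `L_m` that is named by a point. -/
def eval (v : Fin n → Fin (m + 1)) : OrdPoint n → Fin (m + 1)
  | min => 0
  | max => Fin.last m
  | var i => v i

/-- The same point when one more point is distinguished. -/
def lift : OrdPoint n → OrdPoint (n + 1)
  | min => min
  | max => max
  | var i => var i.castSucc

/-- The point that was distinguished last. -/
def last : OrdPoint (n + 1) := var (Fin.last n)

@[simp]
theorem eval_lift (x : OrdPoint n) (v : Fin n → Fin (m + 1)) (u : Fin (m + 1)) :
    x.lift.eval (Fin.snoc v u : Fin (n + 1) → Fin (m + 1)) = x.eval v := by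
  cases x <;> simp [lift, eval]

@[simp]
theorem eval_last (v : Fin n → Fin (m + 1)) (u : Fin (m + 1)) :
    (last (n := n)).eval (Fin.snoc v u : Fin (n + 1) → Fin (m + 1)) = u := by
  simp [last, eval]

/-- The term that denotes a point. -/
def toTerm : OrdPoint n → ordLang.Term (Empty ⊕ Fin n)
  | min => .func (l := 0) OrdFunc.min Fin.elim0
  | max => .func (l := 0) OrdFunc.max Fin.elim0
  | var i => .var (.inr i)

theorem realize_toTerm (x : OrdPoint n) (e : Empty → Fin (m + 1)) (v : Fin n → Fin (m + 1)) :
    x.toTerm.realize (Sum.elim e v) = x.eval v := by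
  cases x <;> rfl

end OrdPoint

/-- `φ` expresses the predicate `P` in every `L_m`. -/
def Expresses {n : ℕ} (φ : ordLang.BoundedFormula Empty n) (P : OrdPred n) : Prop :=
  ∀ (m : ℕ) (e : Empty → Fin (m + 1)) (v : Fin n → Fin (m + 1)), φ.Realize e v ↔ P m v

theorem quantifierRank_le_numQuantifiers {n : ℕ} (φ : ordLang.BoundedFormula Empty n) :
    quantifierRank φ ≤ numQuantifiers φ := by
  induction φ with
  | falsum | equal | rel => simp [quantifierRank]
  | imp φ ψ ih1 ih2 => simp only [quantifierRank, numQuantifiers]; omega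
  | all φ ih => simpa [quantifierRank, numQuantifiers] using ih

theorem numQuantifiers_of_isQF {n : ℕ} {φ : ordLang.BoundedFormula Empty n} (h : φ.IsQF) :
    numQuantifiers φ = 0 := by
  induction h with
  | falsum => rfl
  | of_isAtomic h => cases h <;> rfl
  | imp _ _ ih1 ih2 => simp only [numQuantifiers]; omega

/-- The predicate `P` is expressed by a quantifier-free formula. -/
def QFPred {n : ℕ} (P : OrdPred n) : Prop :=
  ∃ φ : ordLang.BoundedFormula Empty n, φ.IsQF ∧ Expresses φ P

namespace QFPred

variable {n : ℕ} {P Q : OrdPred n}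

theorem lt (x y : OrdPoint n) : QFPred fun _ v => x.eval v < y.eval v := by
  refine ⟨.rel (l := 2) OrdRel.lt ![x.toTerm, y.toTerm], .of_isAtomic (.rel _ _), ?_⟩
  intro m e v
  change (_ < _) ↔ _
  simp [OrdPoint.realize_toTerm]

theorem const (c : Prop) : QFPred (n := n) fun _ _ => c := by
  by_cases hc : c
  · exact ⟨⊤, .top, fun m e v => by simp [hc]⟩
  · exact ⟨⊥, .falsum, fun m e v => by simp [hc]⟩

theorem not (h : QFPred P) : QFPred fun m v => ¬ P m v := by
  obtain ⟨φ, h1, h2⟩ := h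
  exact ⟨φ.not, h1.not, fun m e v => by simp [h2 m e v]⟩

theorem and (h : QFPred P) (h' : QFPred Q) : QFPred fun m v => P m v ∧ Q m v := by
  obtain ⟨φ, h1, h2⟩ := h
  obtain ⟨ψ, h3, h4⟩ := h'
  exact ⟨φ ⊓ ψ, h1.inf h3, fun m e v => by simp [h2 m e v, h4 m e v]⟩

theorem congr (h : QFPred P) (hPQ : ∀ m v, Q m v ↔ P m v) : QFPred Q := by
  obtain ⟨φ, h1, h2⟩ := h
  exact ⟨φ, h1, fun m e v => (h2 m e v).trans (hPQ m v).symm⟩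

theorem imp (h : QFPred P) (h' : QFPred Q) : QFPred fun m v => P m v → Q m v :=
  (h.and h'.not).not.congr fun m v => by tauto

theorem lift (h : QFPred P) :
    QFPred (n := n + 1) fun _ v => P _ (v ∘ Fin.castSucc) := by
  obtain ⟨φ, h1, h2⟩ := h
  refine ⟨φ.liftAt 1 n, h1.liftAt, fun m e v => ?_⟩
  rw [BoundedFormula.realize_liftAt_one_self, h2]

theorem add_le {a : ℕ} (ha : a ≤ 1) (x y : OrdPoint n) :
    QFPred fun _ v => (x.eval v : ℕ) + a ≤ y.eval v := by
  obtain rfl | rfl : a = 0 ∨ a = 1 := by omega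
  · exact (lt y x).not.congr fun m v => by simp only [add_zero, Fin.lt_def, not_lt]
  · exact (lt x y).congr fun m v => by simp only [Fin.lt_def, Nat.succ_le_iff]

end QFPred

/-! ### Upper bound for the rank -/

/-- The predicate `P` is expressed by a formula of quantifier rank at most `k`. -/
def RankPred (k : ℕ) {n : ℕ} (P : OrdPred n) : Prop :=
  ∃ φ : ordLang.BoundedFormula Empty n, quantifierRank φ ≤ k ∧ Expresses φ P

theorem rankPred_add_le (k : ℕ) : ∀ {n a : ℕ}, a ≤ 2 ^ k → ∀ x y : OrdPoint n,
    RankPred k fun _ v => (x.eval v : ℕ) + a ≤ y.eval v := by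
  induction k with
  | zero =>
    intro n a ha x y
    obtain ⟨φ, h1, h2⟩ := QFPred.add_le (by simpa using ha) x y
    exact ⟨φ, (quantifierRank_le_numQuantifiers φ).trans (numQuantifiers_of_isQF h1).le, h2⟩
  | succ k ih =>
    intro n a ha x y
    rw [pow_succ] at ha
    obtain ⟨φ, h1, h2⟩ := ih (a := a / 2) (by omega) x.lift .last
    obtain ⟨ψ, h3, h4⟩ := ih (a := a - a / 2) (by omega) .last y.lift
    refine ⟨(φ ⊓ ψ).ex, ?_, fun m e v => ?_⟩
    · change max (max (max (max (quantifierRank φ) (max (quantifierRank ψ) 0)) 0) 0 + 1) 0 ≤ _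
      simp [h1, h3]
    · rw [BoundedFormula.realize_ex]
      simp only [BoundedFormula.realize_inf, h2 m e, h4 m e, OrdPoint.eval_lift,
        OrdPoint.eval_last]
      constructor
      · rintro ⟨u, h5, h6⟩
        omega
      · intro h
        exact ⟨⟨x.eval v + a / 2, by omega⟩, by simp, by simp only; omega⟩

/-! ### Predicates with a prescribed prefix -/

/-- The predicate `P` is expressed by a prenex formula whose sequence of quantifiers is `w`. -/
def PrefixPred : List Quantifier → {n : ℕ} → OrdPred n → Prop
  | [], _, P => QFPred P
  | .all :: w, n, P => ∃ P' : OrdPred (n + 1), PrefixPred w P' ∧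
      ∀ m v, P m v ↔ ∀ u, P' m (Fin.snoc v u)
  | .ex :: w, n, P => ∃ P' : OrdPred (n + 1), PrefixPred w P' ∧
      ∀ m v, P m v ↔ ∃ u, P' m (Fin.snoc v u)

/-- The dual quantifier. -/
def Quantifier.dual : Quantifier → Quantifier
  | .all => .ex
  | .ex => .all

namespace PrefixPred

theorem congr {w : List Quantifier} {n : ℕ} {P Q : OrdPred n} (h : PrefixPred w P)
    (hPQ : ∀ m v, Q m v ↔ P m v) : PrefixPred w Q := by
  rwa [show Q = P from funext₂ fun m v => propext (hPQ m v)]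

theorem const (w : List Quantifier) (c : Prop) :
    ∀ {n : ℕ}, PrefixPred (n := n) w fun _ _ => c := by
  induction w with
  | nil => exact QFPred.const c
  | cons q w ih => cases q <;> exact ⟨_, ih, by simp⟩

theorem not (w : List Quantifier) : ∀ {n : ℕ} {P : OrdPred n}, PrefixPred w P →
    PrefixPred (w.map Quantifier.dual) fun m v => ¬ P m v := by
  induction w with
  | nil => intro n P h; exact QFPred.not h
  | cons q w ih =>
    intro n P h
    cases q <;> obtain ⟨P', h1, h2⟩ := h <;> exact ⟨_, ih h1, by simp [h2]⟩

/-- The condition ignores the quantified variables, so both branches can share one prefix; this is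
what keeps the quantifier count from adding up. -/
theorem ite (w : List Quantifier) : ∀ {n : ℕ} {c P Q : OrdPred n}, QFPred c → PrefixPred w P →
    PrefixPred w Q → PrefixPred w fun m v => (c m v → P m v) ∧ (¬ c m v → Q m v) := by
  induction w with
  | nil => intro n c P Q hc hP hQ; exact (hc.imp hP).and (hc.not.imp hQ)
  | cons q w ih =>
    intro n c P Q hc hP hQ
    cases q <;> obtain ⟨P', h1, h2⟩ := hP <;> obtain ⟨Q', h3, h4⟩ := hQ <;>
      refine ⟨_, ih hc.lift h1 h3, fun m v => ?_⟩ <;> by_cases h : c m v <;>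
      simp [h, h2, h4, Function.comp_def]

theorem qf_and {w : List Quantifier} {n : ℕ} {c P : OrdPred n} (hc : QFPred c)
    (hP : PrefixPred w P) : PrefixPred w fun m v => c m v ∧ P m v :=
  (ite w hc hP (const w False)).congr fun m v => by tauto

theorem exists_isPrenex (w : List Quantifier) : ∀ {n : ℕ} {P : OrdPred n}, PrefixPred w P →
    ∃ φ : ordLang.BoundedFormula Empty n, φ.IsPrenex ∧ numQuantifiers φ = w.length ∧
      Expresses φ P ∧ ∀ q ∈ w.head?, IsPrenexStartingWith q φ := by
  induction w with
  | nil =>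
    intro n P h
    obtain ⟨φ, h1, h2⟩ := h
    exact ⟨φ, h1.isPrenex, numQuantifiers_of_isQF h1, h2, by simp⟩
  | cons q w ih =>
    intro n P h
    cases q <;> obtain ⟨P', h1, h2⟩ := h <;> obtain ⟨ψ, h3, h4, h5, -⟩ := ih h1
    · refine ⟨ψ.all, h3.all, by simp [numQuantifiers, h4], fun m e v => ?_, ?_⟩
      · simp [h2, h5 m e]
      · simp only [List.head?_cons, Option.mem_some_iff, forall_eq']
        exact ⟨ψ, h3, rfl⟩
    · refine ⟨ψ.ex, h3.ex, ?_, fun m e v => ?_, ?_⟩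
      · change numQuantifiers ψ + 0 + 1 + 0 = _
        simp [h4]
      · simp [h2, h5 m e]
      · simp only [List.head?_cons, Option.mem_some_iff, forall_eq']
        exact ⟨ψ, h3, rfl⟩

end PrefixPred

/-! ### Two adjacent intervals with one prefix -/

/-- The quantifier sequence `w` suffices to say that two adjacent intervals both have given lengths
of at most `S`. -/
def ExpressesBoth (w : List Quantifier) (S : ℕ) : Prop :=
  ∀ ⦃n a b : ℕ⦄, a ≤ S → b ≤ S → ∀ x z y : OrdPoint n,
    PrefixPred w fun _ v => (x.eval v : ℕ) + a ≤ z.eval v ∧ (z.eval v : ℕ) + b ≤ y.eval v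

/-- The quantifier sequence `w` suffices to say that one of two adjacent intervals has a given positive
length of at most `S`. -/
def ExpressesEither (w : List Quantifier) (S : ℕ) : Prop :=
  ∀ ⦃n a b : ℕ⦄, 1 ≤ a → a ≤ S → 1 ≤ b → b ≤ S → ∀ x z y : OrdPoint n,
    PrefixPred w fun _ v => (x.eval v : ℕ) ≤ z.eval v ∧ (z.eval v : ℕ) ≤ y.eval v ∧
      ((x.eval v : ℕ) + a ≤ z.eval v ∨ (z.eval v : ℕ) + b ≤ y.eval v)

theorem expressesBoth_nil : ExpressesBoth [] 1 :=
  fun _ _ _ ha hb x z y => (QFPred.add_le ha x z).and (QFPred.add_le hb z y)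

theorem expressesEither_ex {w : List Quantifier} {S : ℕ}
    (h : ∀ {n a : ℕ}, 1 ≤ a → a ≤ S → ∀ x u z : OrdPoint n, PrefixPred w fun _ v =>
      (x.eval v : ℕ) + a / 2 ≤ u.eval v ∧ (u.eval v : ℕ) + (a - a / 2) ≤ z.eval v) :
    ExpressesEither (.ex :: w) S := by
  intro n a b ha haS hb hbS x z y
  have le (x y : OrdPoint (n + 1)) := QFPred.add_le (Nat.zero_le 1) x y
  have hA := h ha haS x.lift .last z.lift
  have hB := h hb hbS z.lift .last y.lift
  refine ⟨_, PrefixPred.qf_and ((le x.lift z.lift).and (le z.lift y.lift))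
    (PrefixPred.ite w (QFPred.lt .last z.lift) hA hB), fun m v => ?_⟩
  simp only [OrdPoint.eval_lift, OrdPoint.eval_last, Fin.lt_def, add_zero]
  constructor
  · rintro ⟨hxz, hzy, h | h⟩
    -- Since `1 ≤ a`, this midpoint lies strictly below `z`, hence selects the left branch.
    · exact ⟨⟨x.eval v + a / 2, by omega⟩, ⟨hxz, hzy⟩, by simp only; omega, by simp only; omega⟩
    · exact ⟨⟨z.eval v + b / 2, by omega⟩, ⟨hxz, hzy⟩, by simp only; omega, by simp only; omega⟩
  · rintro ⟨u, ⟨hxz, hzy⟩, h1, h2⟩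
    rcases lt_or_ge (u : ℕ) (z.eval v) with hu | hu
    · have := h1 hu
      omega
    · have := h2 hu.not_gt
      omega

theorem ExpressesBoth.ex {w : List Quantifier} {S : ℕ} (h : ExpressesBoth w S) :
    ExpressesEither (.ex :: w) (2 * S) :=
  expressesEither_ex fun _ _ x u z => h (by omega) (by omega) x u z

theorem expressesEither_ex_ex : ExpressesEither [.ex, .ex] 3 := by
  refine expressesEither_ex fun {n a} ha ha3 x u z => ?_
  -- The left part `a / 2 ≤ 1` needs no quantifier. For the right part the left interval is
  -- degenerate, `[u, u]`, so its alternative is false.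
  refine (PrefixPred.qf_and ((QFPred.add_le (a := a / 2) (by omega) x u).and
    (QFPred.add_le (Nat.zero_le 1) u z)) (expressesBoth_nil.ex le_rfl (by norm_num)
      (b := a - a / 2) (by omega) (by omega) u u z)).congr fun m v => ?_
  omega

/-- The two thresholds sum to `a + 1`: a point failing both would force `z - x ≤ a - 1`. -/
theorem add_le_iff_forall_between {x z a m : ℕ} (hz : z ≤ m) (hxz : x + min a 1 ≤ z) :
    x + a ≤ z ↔ ∀ u : Fin (m + 1), x ≤ u → (u : ℕ) < z →
      x + (a + 1) / 2 ≤ u ∨ (u : ℕ) + (a + 1 - (a + 1) / 2) ≤ z := by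
  constructor
  · intro h u h1 h2
    omega
  · intro h
    rcases Nat.eq_zero_or_pos a with rfl | ha
    · omega
    · by_cases hd : z - x < (a + 1) / 2
      · have := h ⟨x, by omega⟩
        simp only at this
        omega
      -- The last point failing the first alternative; the second then gives the full length `a`.
      · have := h ⟨x + (a + 1) / 2 - 1, by omega⟩
        simp only at this
        omega

theorem ExpressesEither.all {w : List Quantifier} {S : ℕ} (h : ExpressesEither w S) :
    ExpressesBoth (.all :: w) (2 * S - 1) := by
  intro n a b ha hb x z y
  have le (x y : OrdPoint (n + 1)) := QFPred.add_le (Nat.zero_le 1) x y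
  have key (c : ℕ) (hc : c ≤ 2 * S - 1) (x z : OrdPoint n) : PrefixPred w fun _ v =>
      (x.lift.eval v : ℕ) ≤ OrdPoint.last.eval v → OrdPoint.last.eval v < z.lift.eval v →
      (x.lift.eval v : ℕ) + (c + 1) / 2 ≤ OrdPoint.last.eval v ∨
        (OrdPoint.last.eval v : ℕ) + (c + 1 - (c + 1) / 2) ≤ z.lift.eval v := by
    rcases Nat.eq_zero_or_pos c with rfl | hc0
    · exact (PrefixPred.const w True).congr fun m v => by
        simp only [Fin.lt_def, iff_true]
        omega
    · refine (PrefixPred.ite w ((le x.lift .last).and (QFPred.lt .last z.lift))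
        (h (a := (c + 1) / 2) (b := c + 1 - (c + 1) / 2) (by omega) (by omega) (by omega)
          (by omega) x.lift .last z.lift) (.const w True)).congr fun m v => ?_
      simp only [Fin.lt_def, add_zero, implies_true, and_true]
      omega
  -- The guards `min a 1` and `min b 1` exclude empty ranges for `u`, where the universal test would
  -- be vacuous although the length is positive.
  refine ⟨_, PrefixPred.qf_and
    ((QFPred.add_le (min_le_right a 1) x z).lift.and (QFPred.add_le (min_le_right b 1) z y).lift)
    (PrefixPred.ite w (QFPred.lt .last z.lift) (key a ha x z) (key b hb z y)), fun m v => ?_⟩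
  have hsnoc (u : Fin (m + 1)) :
      (Fin.snoc v u : Fin (n + 1) → Fin (m + 1)) ∘ Fin.castSucc = v := by
    funext i
    simp
  simp only [OrdPoint.eval_lift, OrdPoint.eval_last, Fin.lt_def, hsnoc]
  by_cases hg : (x.eval v : ℕ) + min a 1 ≤ z.eval v ∧ (z.eval v : ℕ) + min b 1 ≤ y.eval v
  · rw [add_le_iff_forall_between (Nat.le_of_lt_succ (z.eval v).isLt) hg.1,
      add_le_iff_forall_between (Nat.le_of_lt_succ (y.eval v).isLt) hg.2, ← forall_and]
    refine forall_congr' fun u => ?_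
    omega
  · simp only [hg, false_and, forall_const, iff_false]
    omega

theorem ExpressesBoth.mono {w : List Quantifier} {S T : ℕ} (h : ExpressesBoth w S) (hT : T ≤ S) :
    ExpressesBoth w T :=
  fun _ _ _ ha hb => h (ha.trans hT) (hb.trans hT)

theorem ExpressesEither.mono {w : List Quantifier} {S T : ℕ} (h : ExpressesEither w S)
    (hT : T ≤ S) : ExpressesEither w T :=
  fun _ _ _ ha haT hb hbT => h ha (haT.trans hT) hb (hbT.trans hT)

/-- The excess `+ 1` makes the induction close: `S ↦ 2 * S - 1` doubles `S - 1`. -/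
theorem exists_prefixes (k : ℕ) :
    (∃ w : List Quantifier, w.length = k + 1 ∧
      ExpressesEither (.ex :: w) (2 ^ (k + 1) + 1)) ∧
    ∃ w : List Quantifier, w.length = k + 1 ∧
      ExpressesBoth (.all :: w) (2 ^ (k + 1) + 1) := by
  induction k with
  | zero => exact ⟨⟨[.ex], rfl, expressesEither_ex_ex⟩, ⟨[.ex], rfl, expressesBoth_nil.ex.all⟩⟩
  | succ k ih =>
    obtain ⟨⟨w, hw, h⟩, ⟨w', hw', h'⟩⟩ := ih
    have hpow : 2 ^ (k + 1 + 1) = 2 * 2 ^ (k + 1) := by ring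
    exact ⟨⟨_, by simp [hw'], h'.ex.mono (by omega)⟩, ⟨_, by simp [hw], h.all.mono (by omega)⟩⟩

/-! ### Separating sentences and the minima -/

theorem separates_of_expresses {ℓ : ℕ} {φ : ordLang.Sentence}
    (h : Expresses φ fun m _ => ¬ ℓ + 1 ≤ m) : Separates ℓ φ :=
  ⟨fun m _ hm => (h m _ _).2 (by omega), fun m hm hφ => (h m _ _).1 hφ hm⟩

theorem exists_separates_quantifierRank_le (ℓ : ℕ) :
    ∃ φ : ordLang.Sentence, Separates ℓ φ ∧ quantifierRank φ ≤ 1 + Nat.log 2 ℓ := by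
  have hlt := Nat.lt_pow_succ_log_self (b := 2) (by norm_num) ℓ
  rw [Nat.succ_eq_one_add] at hlt
  obtain ⟨φ, h1, h2⟩ := rankPred_add_le (n := 0) (1 + Nat.log 2 ℓ) hlt .min .max
  refine ⟨∼φ, separates_of_expresses fun m e v => ?_, ?_⟩
  · rw [BoundedFormula.realize_not, h2]
    simp [OrdPoint.eval]
  · change max (quantifierRank φ) 0 ≤ _
    simpa using h1

theorem exists_separates_starting (Q : Quantifier) (ℓ : ℕ) :
    ∃ φ : ordLang.Sentence, (Separates ℓ φ ∧ IsPrenexStartingWith Q φ) ∧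
      numQuantifiers φ = 1 + Nat.log 2 ℓ + 1 := by
  have hlt := Nat.lt_pow_succ_log_self (b := 2) (by norm_num) ℓ
  rw [Nat.succ_eq_add_one] at hlt
  -- The prefix is dual to `Q` because the separating sentence is the negation of `ℓ + 1 ≤ m`.
  obtain ⟨w, hw, h⟩ : ∃ w : List Quantifier, w.length = Nat.log 2 ℓ + 1 ∧
      PrefixPred (n := 0) (Q.dual :: w) fun m _ => ℓ + 1 ≤ m := by
    obtain ⟨⟨w, hw, h⟩, ⟨w', hw', h'⟩⟩ := exists_prefixes (Nat.log 2 ℓ)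
    cases Q with
    | all =>
      -- With left interval `[min, min]`, the length `1` makes its alternative false.
      refine ⟨w, hw, (h (a := 1) (b := ℓ + 1) le_rfl (by omega) (by omega) (by omega)
        .min .min .max).congr fun m v => ?_⟩
      simp [OrdPoint.eval]
    | ex =>
      refine ⟨w', hw', (h' (a := 0) (b := ℓ + 1) (by omega) (by omega)
        .min .min .max).congr fun m v => ?_⟩
      simp [OrdPoint.eval]
  obtain ⟨φ, -, h1, h2, h3⟩ := PrefixPred.exists_isPrenex _ h.not
  refine ⟨φ, ⟨separates_of_expresses h2, h3 Q ?_⟩, ?_⟩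
  · cases Q <;> rfl
  · simp [h1, hw, add_comm]

theorem minRank_eq {ℓ : ℕ} (hℓ : 1 ≤ ℓ) : minRank ℓ = ((1 + Nat.log 2 ℓ : ℕ) : ℕ∞) := by
  refine le_antisymm ?_ (le_iInf₂ fun φ h => Nat.cast_le.2 (h.log_lt_quantifierRank hℓ))
  obtain ⟨φ, h1, h2⟩ := exists_separates_quantifierRank_le ℓ
  exact (iInf₂_le φ h1).trans (Nat.cast_le.2 h2)

theorem minQuantStarting_le (Q : Quantifier) {ℓ : ℕ} (hℓ : 1 ≤ ℓ) :
    minQuantStarting Q ℓ ≤ minRank ℓ + 1 := by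
  obtain ⟨φ, h1, h2⟩ := exists_separates_starting Q ℓ
  refine (iInf₂_le φ h1).trans ?_
  rw [minRank_eq hℓ, h2]
  exact le_rfl

theorem minRank_le_minQuant (ℓ : ℕ) : minRank ℓ ≤ minQuant ℓ :=
  iInf₂_mono fun φ _ => Nat.cast_le.2 (quantifierRank_le_numQuantifiers φ)

theorem minQuant_le_minQuantStarting (Q : Quantifier) (ℓ : ℕ) :
    minQuant ℓ ≤ minQuantStarting Q ℓ :=
  le_iInf₂ fun φ h => iInf₂_le φ h.1

end LinOrdSep

theorem mainTheorem4 (ℓ : ℕ) (hℓ : 1 ≤ ℓ) :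
    LinOrdSep.minRank ℓ = ((1 + Nat.log 2 ℓ : ℕ) : ℕ∞) ∧
    LinOrdSep.minRank ℓ ≤ LinOrdSep.minQuant ℓ ∧
    LinOrdSep.minQuant ℓ ≤ LinOrdSep.minRank ℓ + 1 ∧
    LinOrdSep.minQuantStarting LinOrdSep.Quantifier.ex ℓ ≤ LinOrdSep.minRank ℓ + 1 ∧
    LinOrdSep.minQuantStarting LinOrdSep.Quantifier.all ℓ ≤ LinOrdSep.minRank ℓ + 1 :=
  ⟨LinOrdSep.minRank_eq hℓ, LinOrdSep.minRank_le_minQuant ℓ,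
    (LinOrdSep.minQuant_le_minQuantStarting .ex ℓ).trans
      (LinOrdSep.minQuantStarting_le .ex hℓ),
    LinOrdSep.minQuantStarting_le .ex hℓ, LinOrdSep.minQuantStarting_le .all hℓ⟩
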